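/- Theorem (global convergence of the augmented Lagrangian method for the PPA subproblem). Let $A\in\mathbb{R}^{n\times p}$, $b\in\mathbb{R}^n$, $\lambda>0$, $\sigma_k>0$, $x^k\in\mathbb{R}^p$, let $h:\mathbb{R}^n\to\mathbb{R}$ be convex, and put $f(z)=\lambda\|z\|_1$. Consider the proximal point subproblem $$\min_{x\in\mathbb{R}^p}\ h(b-Ax)+\lambda\|x\|_1+\frac{1}{2\sigma_k}\|x-x^k\|^2 \qquad (\mathrm{P})$$ in its equivalent split form $$\min_{x,u,z}\ h(u)+\lambda\|z\|_1+\frac{1}{2\sigma_k}\|x-x^k\|^2\quad\text{s.t. } u=b-Ax,\ z=x. \qquad (\mathrm{P}')$$ For $\alpha=(\alpha_1,\alpha_2)\in\mathbb{R}^n\times\mathbb{R}^p$ and $\rho>0$ let $$\mathcal{L}(x,u,z;\alpha)=h(u)+\lambda\|z\|_1-\langle u-b+Ax,\alpha_1\rangle-\langle z-x,\alpha_2\rangle+\frac{1}{2\sigma_k}\|x-x^k\|^2,$$ $$L_\rho(x,u,z,\alpha)=\mathcal{L}(x,u,z;\alpha)+\frac{\rho}{2}\|u-b+Ax\|^2+\frac{\rho}{2}\|z-x\|^2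 .$$ Let $\{\rho_j\}_{j\ge0}$ be positive penalty parameters that are bounded away from zero (for instance, positive and nondecreasing), and let $\epsilon_j\ge0$ with $\sum_j\epsilon_j<\infty$. Let $\{(x^j,u^j,z^j,\alpha^j)\}_{j\ge 0}$ be an infinite sequence, with arbitrary starting point, generated by the augmented Lagrangian method in which the inner problem is solved inexactly: for every $j\ge0$, $$u^{j+1}=\mathrm{Prox}_{\frac1{\rho_j}h}\Big(b-Ax^{j+1}+\tfrac1{\rho_j}\alpha_1^j\Big),\qquad z^{j+1}=\mathrm{Prox}_{\frac{\lambda}{\rho_j}\|\cdot\|_1}\Big(x^{j+1}+\tfrac1{\rho_j}\alpha_2^j\Big),$$ where $\mathrm{Prox}_q(x)=\arg\min_y\{q(y)+\frac12\|y-x\|^2\}$; the point $x^{j+1}$ is such that the stopping criterion $$(\mathrm{C})\qquad L_{\rho_j}(x^{j+1},u^{j+1},z^{j+1},\alpha^j)-\inf_{x,u,z}L_{\rho_j}(x,u,z,\alpha^j)\le\frac{\epsilon_j^2}{2\rho_j}$$ holds; and $$\alpha^{j+1}=\alpha^j-\rho_j\begin{bmatrix}u^{j+1}-b+Ax^{j+1}\\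 z^{j+1}-x^{j+1}\end{bmatrix}.$$ Then the following hold. (i) The (Lagrangian) dual problem of $(\mathrm{P}')$ is $$\max_{\alpha\in\mathbb{R}^{n+p}}\Big\{-\phi(\alpha):=-\frac{\sigma_k}{2}\|A^\top\alpha_1-\alpha_2\|^2+\langle b,\alpha_1\rangle-\langle x^k,A^\top\alpha_1-\alpha_2\rangle-h^*(\alpha_1)-f^*(\alpha_2)\Big\},\qquad (\mathrm{D})$$ that is, $\inf_{x,u,z}\mathcal{L}(x,u,z;\alpha)=-\phi(\alpha)$ in $[-\infty,\infty)$ for every $\alpha$, where $q^*(y)=\sup_x\{\langle x,y\rangle-q(x)\}$ denotes the conjugate function. (ii) The sequence $\{\alpha^j\}$ is bounded and converges to an optimal solution of $(\mathrm{D})$. (iii) The sequence $\{(x^j,u^j,z^j)\}$ is bounded and converges to the unique optimal solution $(x^*,u^*,z^*)$ of $(\mathrm{P}')$; in particular $x^*$ is the unique optimal solution of $(\mathrm{P})$. -/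

import Mathlib

open Set Filter Topology

noncomputable section

namespace RankLasso

/-- `ℝ^m` with the Euclidean norm. -/
abbrev Vec (m : ℕ) : Type := EuclideanSpace ℝ (Fin m)

/-- The `ℓ₁` norm of a vector. -/
def l1norm {m : ℕ} (z : Vec m) : ℝ := ∑ i, |z i|

/-- The (Fenchel) conjugate `q^*(y) = sup_x (⟨x, y⟩ - q x)` of a real-valued function,
with values in the extended reals. -/
def conjugate {m : ℕ} (q : Vec m → ℝ) (y : Vec m) : EReal :=
  ⨆ x : Vec m, ((inner ℝ x y - q x : ℝ) : EReal)

/-- `y = Prox_q(x)`: `y` minimizes `q(y) + ½‖y - x‖²` (for convex `q` there is exactly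
one such `y`). -/
def IsProx {m : ℕ} (q : Vec m → ℝ) (x y : Vec m) : Prop :=
  IsMinOn (fun w => q w + 1 / 2 * ‖w - x‖ ^ 2) univ y

/-- The data of one proximal point subproblem
`min_x h(b - A x) + λ‖x‖₁ + (1 / (2σ)) ‖x - c‖²`, where `c` is the proximal centre. -/
structure PPASubproblem (n p : ℕ) where
  A : Matrix (Fin n) (Fin p) ℝ
  b : Vec n
  h : Vec n → ℝ
  lam : ℝ
  sigma : ℝ
  center : Vec p

namespace PPASubproblem

variable {n p : ℕ} (P : PPASubproblem n p)

/-- The product `A x`. -/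
def mulA (x : Vec p) : Vec n := Matrix.toEuclideanLin P.A x

/-- The product `Aᵀ α₁`. -/
def mulAT (a : Vec n) : Vec p := Matrix.toEuclideanLin P.A.transpose a

/-- The regularizer `f(z) = λ‖z‖₁`. -/
def f (z : Vec p) : ℝ := P.lam * l1norm z

/-- The objective of the proximal point subproblem in the variable `x` alone. -/
def objective (x : Vec p) : ℝ :=
  P.h (P.b - P.mulA x) + P.lam * l1norm x + 1 / (2 * P.sigma) * ‖x - P.center‖ ^ 2

/-- The objective of the split form in the variables `(x, u, z)`. -/
def splitObjective (w : Vec p × Vec n × Vec p) : ℝ :=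
  P.h w.2.1 + P.lam * l1norm w.2.2 + 1 / (2 * P.sigma) * ‖w.1 - P.center‖ ^ 2

/-- The feasible set of the split form: `u = b - A x` and `z = x`. -/
def feasible : Set (Vec p × Vec n × Vec p) :=
  {w | w.2.1 = P.b - P.mulA w.1 ∧ w.2.2 = w.1}

/-- Optimal solutions of the split form. -/
def IsSolution (w : Vec p × Vec n × Vec p) : Prop :=
  w ∈ P.feasible ∧ IsMinOn P.splitObjective P.feasible w

/-- The Lagrangian of the split form, with multipliers `α = (α₁, α₂)`. -/
def lagrangian (w : Vec p × Vec n × Vec p) (α : Vec n × Vec p) : ℝ :=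
  P.h w.2.1 + P.lam * l1norm w.2.2
    - inner ℝ (w.2.1 - P.b + P.mulA w.1) α.1
    - inner ℝ (w.2.2 - w.1) α.2
    + 1 / (2 * P.sigma) * ‖w.1 - P.center‖ ^ 2

/-- The augmented Lagrangian of the split form, with penalty parameter `ρ`. -/
def augLagrangian (ρ : ℝ) (w : Vec p × Vec n × Vec p) (α : Vec n × Vec p) : ℝ :=
  P.h w.2.1 + P.lam * l1norm w.2.2
    - inner ℝ (w.2.1 - P.b + P.mulA w.1) α.1
    - inner ℝ (w.2.2 - w.1) α.2
    + ρ / 2 * ‖w.2.1 - P.b + P.mulA w.1‖ ^ 2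
    + ρ / 2 * ‖w.2.2 - w.1‖ ^ 2
    + 1 / (2 * P.sigma) * ‖w.1 - P.center‖ ^ 2

/-- The function `φ` such that the dual problem is to maximize `-φ`. -/
def phi (α : Vec n × Vec p) : EReal :=
  ((P.sigma / 2 * ‖P.mulAT α.1 - α.2‖ ^ 2 - inner ℝ P.b α.1
      + inner ℝ P.center (P.mulAT α.1 - α.2) : ℝ) : EReal)
    + conjugate P.h α.1 + conjugate P.f α.2

/-- Optimal solutions of the dual problem `max_α -φ(α)`: `α` is feasible (`φ(α) < ∞`) and
maximizes `-φ`. -/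
def IsDualSolution (α : Vec n × Vec p) : Prop :=
  P.phi α < ⊤ ∧ IsMaxOn (fun β => -P.phi β) univ α

/-- An infinite run of the augmented Lagrangian method with penalty parameters `ρ j`, in which
the inner problem for `x^{j+1}` is solved inexactly, up to the stopping criterion
`L_{ρ_j}(x^{j+1}, u^{j+1}, z^{j+1}; α^j) - inf L_{ρ_j}(·; α^j) ≤ ε_j² / (2 ρ_j)`.
The starting point is arbitrary; an exact run is a run for every `ε`. For convex `h` and
positive `λ, σ, ρ_j` the real infimum is that of a function that is bounded below. -/
structure IsALMRun (ρ ε : ℕ → ℝ) (x : ℕ → Vec p) (u : ℕ → Vec n) (z : ℕ → Vec p)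
    (α : ℕ → Vec n × Vec p) : Prop where
  /-- `u^{j+1} = Prox_{h/ρ_j}(b - A x^{j+1} + α₁^j / ρ_j)` -/
  u_step : ∀ j, IsProx (fun v => 1 / ρ j * P.h v)
    (P.b - P.mulA (x (j + 1)) + (1 / ρ j) • (α j).1) (u (j + 1))
  /-- `z^{j+1} = Prox_{λ‖·‖₁/ρ_j}(x^{j+1} + α₂^j / ρ_j)` -/
  z_step : ∀ j, IsProx (fun v => P.lam / ρ j * l1norm v)
    (x (j + 1) + (1 / ρ j) • (α j).2) (z (j + 1))
  /-- the stopping criterion of the inner problem -/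
  criterion : ∀ j,
    P.augLagrangian (ρ j) (x (j + 1), u (j + 1), z (j + 1)) (α j)
      - ⨅ w, P.augLagrangian (ρ j) w (α j) ≤ ε j ^ 2 / (2 * ρ j)
  /-- the multiplier update -/
  multiplier_step : ∀ j, α (j + 1) = α j
    - ρ j • (u (j + 1) - P.b + P.mulA (x (j + 1)), z (j + 1) - x (j + 1))

end PPASubproblem

end RankLasso

end

/-!
With the residual `y = (u - b + A x, z - x)` in place of `(u, z)`, the split problem becomes the
minimization of `g (x, y) + κ‖x - c‖²` subject to `y = 0`, where `g` is a finite convex function on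
a finite-dimensional space and `κ = 1 / (2σ)`. The convergence theorem `exists_tendsto_isKKTPair` is
proved for every such `g`.

An exact minimizer `w` of the augmented Lagrangian at `α` minimizes the ordinary Lagrangian at the
updated multiplier `α - r • w.2`, with quadratic growth `κ‖x - w.1‖²` (`pertLag_growth`). Two
consequences carry the proof. First, the stopping criterion says that the inexact multiplier differs
from the exact one by at most `ε j` (`norm_residual_sub_le`), and that the inexact primal point is
close to `w`. Second, adding the growth inequalities at `w` and at a Kuhn-Tucker pair `(x, β)` gives
`‖α⁺ - β‖² + ‖α - α⁺‖² + 4κr‖w.1 - x‖² ≤ ‖α - β‖²` for the exact step `α⁺` (`IsKKTPair.fejer`).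

Hence the distance of the multipliers to each dual solution converges, the successive differences
`α - α⁺` tend to zero, and, as the penalties are bounded away from zero, the exact minimizers
converge to `(x, 0)`. A cluster point of the multipliers is again part of a Kuhn-Tucker pair, by
continuity of the Lagrangian, so the distance to it tends to zero. A Kuhn-Tucker pair exists as a
limit of minimizers of penalized problems (`exists_isKKTPair`). The dual function is computed by
completing the square in `x` (`iInf_lagrangian`).
-/

namespace RankLasso

/-! ### Convex programs with a perturbed constraint -/

section Abstract

variable {X Y : Type*} [NormedAddCommGroup X] [NormedAddCommGroup Y] [InnerProductSpace ℝ Y]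

/-- The Lagrangian of the problem of minimizing `g (x, y) + κ‖x - c‖²` subject to `y = 0`, with
multiplier `β`. -/
noncomputable def pertLag (g : X × Y → ℝ) (κ : ℝ) (c : X) (v : X × Y) (β : Y) : ℝ :=
  g v + κ * ‖v.1 - c‖ ^ 2 - inner ℝ v.2 β

/-- The augmented Lagrangian, with penalty parameter `r`, of the problem of minimizing
`g (x, y) + κ‖x - c‖²` subject to `y = 0`. -/
noncomputable def pertAugLag (g : X × Y → ℝ) (κ : ℝ) (c : X) (r : ℝ) (v : X × Y) (β : Y) : ℝ :=
  pertLag g κ c v β + r / 2 * ‖v.2‖ ^ 2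

/-- `(x, β)` is a Kuhn-Tucker pair: the feasible point `(x, 0)` minimizes the Lagrangian with
multiplier `β`. -/
def IsKKTPair (g : X × Y → ℝ) (κ : ℝ) (c : X) (x : X) (β : Y) : Prop :=
  ∀ v, pertLag g κ c (x, 0) β ≤ pertLag g κ c v β

variable {g : X × Y → ℝ} {κ : ℝ} {c : X}

lemma pertAugLag_add_smul (v : X × Y) (α : Y) (r : ℝ) (w : X × Y) :
    pertAugLag g κ c r v α = pertLag g κ c v (α - r • w.2) - r * inner ℝ v.2 w.2
      + r / 2 * ‖v.2‖ ^ 2 := by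
  unfold pertAugLag pertLag
  rw [inner_sub_right, inner_smul_right]
  ring

variable [InnerProductSpace ℝ X]

/-- A finite convex function decreases at most linearly: its value at the origin bounds its
value at `v` from below, given its bound on the unit ball. -/
lemma exists_forall_le_of_convexOn {E : Type*} [NormedAddCommGroup E] [NormedSpace ℝ E]
    [FiniteDimensional ℝ E] {q : E → ℝ} (hq : ConvexOn ℝ univ q) :
    ∃ K : ℝ, 0 ≤ K ∧ ∀ v, -K * (1 + ‖v‖) ≤ q v := by
  have hcont : Continuous q := hq.locallyLipschitz.continuous
  obtain ⟨M, hM⟩ := (isCompact_closedBall (0 : E) 1).exists_bound_of_continuousOn hcont.continuousOn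
  have h0 := hM 0 (by simp)
  have hM0 : 0 ≤ M := (norm_nonneg _).trans h0
  refine ⟨2 * M, by positivity, fun v => ?_⟩
  -- The origin is a convex combination of `v` and of the opposite point of the unit ball.
  set w : E := -(‖v‖⁻¹ • v) with hw
  have hwn : ‖w‖ ≤ 1 := by
    rw [hw, norm_neg, norm_smul, norm_inv, norm_norm]
    exact inv_mul_le_one
  have hgw := hM w (by simpa using hwn)
  have hpos : 0 < 1 + ‖v‖ := by positivity
  have hvw : ‖v‖ • w = -v := by
    rcases eq_or_ne v 0 with rfl | hv
    · simp
    · rw [hw, smul_neg, smul_smul, mul_inv_cancel₀ (norm_ne_zero_iff.2 hv), one_smul]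
  have hc := hq.2 (mem_univ v) (mem_univ w) 
    (by positivity : 0 ≤ (1 + ‖v‖)⁻¹) (by positivity : 0 ≤ (1 + ‖v‖)⁻¹ * ‖v‖) (by field_simp)
  rw [mul_smul, hvw, smul_neg, add_neg_cancel, smul_eq_mul, smul_eq_mul] at hc
  have hc' : (1 + ‖v‖) * q 0 ≤ q v + ‖v‖ * q w := by
    calc (1 + ‖v‖) * q 0 ≤ (1 + ‖v‖) * ((1 + ‖v‖)⁻¹ * q v + (1 + ‖v‖)⁻¹ * ‖v‖ * q w) := by gcongr
      _ = q v + ‖v‖ * q w := by field_simp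
  rw [Real.norm_eq_abs, abs_le] at h0 hgw
  nlinarith [norm_nonneg v, mul_le_mul_of_nonneg_left hgw.2 (norm_nonneg v),
    mul_le_mul_of_nonneg_left h0.1 hpos.le]

/-- The Lagrangian is strongly convex in the variable `x`, with modulus `2κ`. -/
lemma pertLag_lineMap_le (hg : ConvexOn ℝ univ g) (v w : X × Y) (β : Y) {t : ℝ} (ht0 : 0 ≤ t)
    (ht1 : t ≤ 1) :
    pertLag g κ c (w + t • (v - w)) β ≤ (1 - t) * pertLag g κ c w β + t * pertLag g κ c v β
      - t * (1 - t) * (κ * ‖v.1 - w.1‖ ^ 2) := by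
  have h1 := hg.2 (mem_univ w) (mem_univ v) (sub_nonneg.2 ht1) ht0 (by ring)
  have h2 : w + t • (v - w) = (1 - t) • w + t • v := by module
  rw [← h2, smul_eq_mul, smul_eq_mul] at h1
  have h3 : ‖(w + t • (v - w)).1 - c‖ ^ 2
      = (1 - t) * ‖w.1 - c‖ ^ 2 + t * ‖v.1 - c‖ ^ 2 - t * (1 - t) * ‖v.1 - w.1‖ ^ 2 := by
    have e1 : (w + t • (v - w)).1 - c = (w.1 - c) + t • ((v.1 - c) - (w.1 - c)) := by
      simp
      abel
    have e2 : v.1 - w.1 = (v.1 - c) - (w.1 - c) := by abel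
    rw [e1, e2]
    generalize w.1 - c = a
    generalize v.1 - c = b
    simp only [← real_inner_self_eq_norm_sq, inner_add_left, inner_add_right, inner_sub_left,
      inner_sub_right, inner_smul_left, inner_smul_right, real_inner_comm a b]
    simp
    ring
  have h4 : inner ℝ (w + t • (v - w)).2 β = (1 - t) * inner ℝ w.2 β + t * inner ℝ v.2 β := by
    simp [inner_add_left, inner_sub_left, inner_smul_left]
    ring
  unfold pertLag
  rw [h3, h4]
  linarith

/-- A minimizer `w` of the augmented Lagrangian at `α` minimizes the ordinary Lagrangian at the
updated multiplier `α - r • w.2`, with quadratic growth in `x`. The case `r = 0` is the growth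
estimate for minimizers of the Lagrangian. -/
lemma pertLag_growth (hg : ConvexOn ℝ univ g) {r : ℝ} {α : Y} {w : X × Y}
    (hw : ∀ v, pertAugLag g κ c r w α ≤ pertAugLag g κ c r v α) (v : X × Y) :
    pertLag g κ c w (α - r • w.2) + κ * ‖v.1 - w.1‖ ^ 2 ≤ pertLag g κ c v (α - r • w.2) := by
  set β := α - r • w.2 with hβ
  set D := κ * ‖v.1 - w.1‖ ^ 2
  set N := r / 2 * ‖v.2 - w.2‖ ^ 2
  have key : ∀ t : ℝ, t ∈ Ioo (0 : ℝ) 1 →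
      pertLag g κ c w β + (1 - t) * D - t * N ≤ pertLag g κ c v β := by
    intro t ht
    have h1 := pertLag_lineMap_le (κ := κ) (c := c) hg v w β ht.1.le ht.2.le
    have h2 := hw (w + t • (v - w))
    rw [pertAugLag_add_smul w α r w, pertAugLag_add_smul (w + t • (v - w)) α r w, ← hβ] at h2
    have h3 : - r * inner ℝ (w + t • (v - w)).2 w.2 + r / 2 * ‖(w + t • (v - w)).2‖ ^ 2
        = - r * inner ℝ w.2 w.2 + r / 2 * ‖w.2‖ ^ 2 + t ^ 2 * N := by
      have e : (w + t • (v - w)).2 = w.2 + t • (v.2 - w.2) := rfl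
      simp only [N]
      rw [e, norm_add_sq_real, inner_add_left, inner_smul_left, inner_smul_right, norm_smul,
        mul_pow, Real.norm_eq_abs, sq_abs, real_inner_comm (v.2 - w.2) w.2]
      simp
      ring
    have h4 : 0 ≤ t * (pertLag g κ c v β - pertLag g κ c w β - (1 - t) * D + t * N) := by
      nlinarith
    linarith [nonneg_of_mul_nonneg_right h4 ht.1]
  have hlim : Tendsto (fun t : ℝ => pertLag g κ c w β + (1 - t) * D - t * N) (𝓝[>] 0)
      (𝓝 (pertLag g κ c w β + (1 - 0) * D - 0 * N)) :=
    (Continuous.tendsto (by fun_prop) 0).mono_left nhdsWithin_le_nhds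
  have := le_of_tendsto hlim
    (eventually_of_mem (Ioo_mem_nhdsGT zero_lt_one) fun t ht => key t ht)
  linarith

lemma IsKKTPair.growth (hg : ConvexOn ℝ univ g) {x : X} {β : Y} (h : IsKKTPair g κ c x β)
    (v : X × Y) :
    pertLag g κ c (x, 0) β + κ * ‖v.1 - x‖ ^ 2 ≤ pertLag g κ c v β := by
  simpa using pertLag_growth (r := 0) (α := β) (w := (x, 0)) hg
    (fun y => by simpa [pertAugLag] using h y) v

lemma pertAugLag_growth (hg : ConvexOn ℝ univ g) {r : ℝ} {α : Y} {w : X × Y}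
    (hw : ∀ v, pertAugLag g κ c r w α ≤ pertAugLag g κ c r v α) (v : X × Y) :
    pertAugLag g κ c r w α + κ * ‖v.1 - w.1‖ ^ 2 + r / 2 * ‖v.2 - w.2‖ ^ 2
      ≤ pertAugLag g κ c r v α := by
  have h := pertLag_growth hg hw v
  rw [pertAugLag_add_smul w α r w, pertAugLag_add_smul v α r w, norm_sub_sq_real v.2,
    real_inner_self_eq_norm_sq]
  linarith

/-! ### Coercivity and existence of Kuhn-Tucker pairs -/

section FiniteDimensional

variable [FiniteDimensional ℝ X] [FiniteDimensional ℝ Y]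

lemma continuous_pertLag (hg : ConvexOn ℝ univ g) :
    Continuous fun p : (X × Y) × Y => pertLag g κ c p.1 p.2 := by
  have := hg.locallyLipschitz.continuous
  unfold pertLag
  fun_prop

lemma exists_linear_le_quadratic {a : ℝ} (ha : 0 < a) (k : ℝ) :
    ∃ C, ∀ s : ℝ, s - C ≤ a * s ^ 2 - k * s := by
  refine ⟨(k + 1) ^ 2 / (4 * a), fun s => ?_⟩
  have h : a * s ^ 2 - k * s - (s - (k + 1) ^ 2 / (4 * a)) = a * (s - (k + 1) / (2 * a)) ^ 2 := by
    field_simp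
    ring
  have : 0 ≤ a * (s - (k + 1) / (2 * a)) ^ 2 := by positivity
  linarith

/-- The augmented Lagrangian is coercive: the quadratic terms dominate the affine minorant of
`g`. -/
lemma exists_norm_le_pertAugLag (hg : ConvexOn ℝ univ g) (hκ : 0 < κ) {r : ℝ} (hr : 0 < r)
    (α : Y) : ∃ C, ∀ v, ‖v‖ ≤ pertAugLag g κ c r v α + C := by
  obtain ⟨K, hK0, hK⟩ := exists_forall_le_of_convexOn hg
  obtain ⟨C₁, hC₁⟩ := exists_linear_le_quadratic hκ K
  obtain ⟨C₂, hC₂⟩ := exists_linear_le_quadratic (half_pos hr) (K + ‖α‖)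
  refine ⟨C₁ + C₂ + K + K * ‖c‖ + ‖c‖, fun v => ?_⟩
  have h1 : ‖v.1‖ ≤ ‖v.1 - c‖ + ‖c‖ := by simpa using norm_add_le (v.1 - c) c
  have h2 : ‖v‖ ≤ ‖v.1‖ + ‖v.2‖ :=
    max_le (le_add_of_nonneg_right (norm_nonneg _)) (le_add_of_nonneg_left (norm_nonneg _))
  have h3 := hC₁ ‖v.1 - c‖
  have h4 := hC₂ ‖v.2‖
  have h5 := real_inner_le_norm v.2 α
  have h6 : K * ‖v‖ ≤ K * (‖v.1 - c‖ + ‖c‖ + ‖v.2‖) := by gcongr; linarith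
  have h7 := hK v
  unfold pertAugLag pertLag
  linarith

lemma exists_isMin_pertAugLag (hg : ConvexOn ℝ univ g) (hκ : 0 < κ) {r : ℝ} (hr : 0 < r)
    (α : Y) : ∃ w, ∀ v, pertAugLag g κ c r w α ≤ pertAugLag g κ c r v α := by
  obtain ⟨C, hC⟩ := exists_norm_le_pertAugLag (c := c) hg hκ hr α
  have hcont : Continuous fun v => pertAugLag g κ c r v α := by
    have := (continuous_pertLag (κ := κ) (c := c) hg).comp (Continuous.prodMk_left α)
    unfold pertAugLag
    exact this.add (by fun_prop)
  refine hcont.exists_forall_le ?_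
  refine tendsto_atTop_mono (fun v => sub_le_iff_le_add.2 (hC v)) ?_
  exact tendsto_atTop_add_const_right _ (-C) (tendsto_norm_cocompact_atTop (E := X × Y))

/-- Existence of a Kuhn-Tucker pair. The minimizers `w k` of the penalized problems with multiplier
`0` and penalty `k + 1` are bounded by coercivity. The multipliers `-(k + 1) • (w k).2` are
bounded because they are subgradients, in the variable `y`, of a continuous function at points of
a bounded set. Every cluster point is a Kuhn-Tucker pair. -/
lemma exists_isKKTPair (hg : ConvexOn ℝ univ g) (hκ : 0 < κ) :
    ∃ x β, IsKKTPair g κ c x β := by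
  choose w hw using fun k : ℕ =>
    exists_isMin_pertAugLag (c := c) hg hκ (r := (k : ℝ) + 1) (by positivity) (0 : Y)
  set β : ℕ → Y := fun k => (0 : Y) - ((k : ℝ) + 1) • (w k).2 with hβ
  have hmin : ∀ k v, pertLag g κ c (w k) (β k) ≤ pertLag g κ c v (β k) := fun k v =>
    (le_add_of_nonneg_right (by positivity)).trans (pertLag_growth hg (hw k) v)
  obtain ⟨C, hC⟩ := exists_norm_le_pertAugLag (c := c) hg hκ one_pos (0 : Y)
  set R := pertLag g κ c 0 (0 : Y) + C with hR
  have hwR : ∀ k, ‖w k‖ ≤ R := by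
    intro k
    have h1 := hC (w k)
    have h2 := hw k 0
    have h3 : pertAugLag g κ c 1 (w k) 0 ≤ pertAugLag g κ c ((k : ℝ) + 1) (w k) 0 := by
      unfold pertAugLag
      gcongr
      linarith [k.cast_nonneg (α := ℝ)]
    have h4 : pertAugLag g κ c ((k : ℝ) + 1) 0 (0 : Y) = pertLag g κ c 0 0 := by
      simp [pertAugLag]
    linarith
  have hFc : Continuous fun v => pertLag g κ c v (0 : Y) :=
    (continuous_pertLag (κ := κ) (c := c) hg).comp (Continuous.prodMk_left (0 : Y))
  obtain ⟨M, hM⟩ := (isCompact_closedBall (0 : X × Y) (R + 1)).exists_bound_of_continuousOn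
    hFc.continuousOn
  have hβM : ∀ k, ‖β k‖ ≤ 2 * M := by
    intro k
    -- the subgradient inequality in the direction of `β k`
    set e : Y := ‖β k‖⁻¹ • β k with he
    have hen : ‖e‖ ≤ 1 := by
      rw [he, norm_smul, norm_inv, norm_norm]
      exact inv_mul_le_one
    have heβ : inner ℝ e (β k) = ‖β k‖ := by
      rw [he, real_inner_smul_left, real_inner_self_eq_norm_sq]
      rcases eq_or_ne ‖β k‖ 0 with h | h
      · simp [h]
      · field_simp
    have h1 := hmin k (w k + (0, e))
    have h2 : ‖w k + ((0, e) : X × Y)‖ ≤ R + 1 :=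
      (norm_add_le _ _).trans (add_le_add (hwR k) (by simpa [Prod.norm_def] using hen))
    have h3 := hM _ (mem_closedBall_zero_iff.2 h2)
    have h4 := hM (w k) (mem_closedBall_zero_iff.2 ((hwR k).trans (by linarith)))
    rw [Real.norm_eq_abs, abs_le] at h3 h4
    simp only [pertLag, Prod.snd_add, inner_add_left, heβ, inner_zero_right] at h1 h3 h4
    linarith
  obtain ⟨⟨v, b⟩, -, φ, hφ, hlim⟩ := tendsto_subseq_of_bounded
    (x := fun k => (w k, β k)) (Metric.isBounded_closedBall (x := (0 : (X × Y) × Y))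
      (r := max R (2 * M))) (fun k => by
      rw [mem_closedBall_zero_iff]
      exact max_le_max (hwR k) (hβM k))
  have hv : Tendsto (fun k => (w (φ k)).2) atTop (𝓝 v.2) := by
    have : Continuous fun p : (X × Y) × Y => p.1.2 := by fun_prop
    exact (this.tendsto (v, b)).comp hlim
  have hv0 : v.2 = 0 := by
    refine tendsto_nhds_unique hv ?_
    have h0 : Tendsto (fun k : ℕ => (2 * M) * (1 / ((k : ℝ) + 1))) atTop (𝓝 0) := by
      simpa using tendsto_one_div_add_atTop_nhds_zero_nat.const_mul (2 * M)
    refine squeeze_zero_norm (fun k => ?_) (h0.comp hφ.tendsto_atTop)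
    have h1 := hβM (φ k)
    simp only [hβ, zero_sub, norm_neg, norm_smul, Real.norm_eq_abs] at h1
    rw [abs_of_pos (by positivity)] at h1
    have h2 : (0 : ℝ) < (φ k : ℝ) + 1 := by positivity
    simp only [Function.comp]
    rw [mul_one_div, le_div_iff₀ h2]
    linarith
  refine ⟨v.1, b, fun y => ?_⟩
  have hvb : ((v.1, (0 : Y)) : X × Y) = v := by rw [← hv0]
  rw [hvb]
  have hL := continuous_pertLag (κ := κ) (c := c) hg
  refine le_of_tendsto_of_tendsto ((hL.tendsto (v, b)).comp hlim)
    (((hL.comp (Continuous.prodMk_right y)).tendsto b).comp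
      ((continuous_snd.tendsto (v, b)).comp hlim))
    (Eventually.of_forall fun k => hmin (φ k) y)

end FiniteDimensional

/-- One exact step of the method of multipliers moves the multiplier towards every dual solution:
this is the firm nonexpansiveness of the proximal step in the dual problem, sharpened by the strong
convexity in `x`. -/
lemma IsKKTPair.fejer (hg : ConvexOn ℝ univ g) {r : ℝ} (hr : 0 < r) {x : X} {β α : Y}
    (h : IsKKTPair g κ c x β) {w : X × Y}
    (hw : ∀ v, pertAugLag g κ c r w α ≤ pertAugLag g κ c r v α) :
    ‖α - r • w.2 - β‖ ^ 2 + ‖r • w.2‖ ^ 2 + 4 * κ * r * ‖w.1 - x‖ ^ 2 ≤ ‖α - β‖ ^ 2 := by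
  have h1 := h.growth hg w
  have h2 := pertLag_growth hg hw (x, 0)
  rw [norm_sub_rev] at h2
  have h3 : 2 * κ * ‖w.1 - x‖ ^ 2 ≤ inner ℝ w.2 (α - r • w.2 - β) := by
    rw [inner_sub_right w.2 (α - r • w.2)]
    unfold pertLag at h1 h2
    simp only [inner_zero_left] at h1 h2
    linarith
  have h4 : ‖α - β‖ ^ 2 = ‖α - r • w.2 - β‖ ^ 2 + ‖r • w.2‖ ^ 2
      + 2 * (r * inner ℝ w.2 (α - r • w.2 - β)) := by
    have e : α - β = (α - r • w.2 - β) + r • w.2 := by abel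
    rw [e, norm_add_sq_real, inner_smul_right, real_inner_comm w.2]
    ring
  rw [h4]
  nlinarith [mul_le_mul_of_nonneg_left h3 hr.le]

end Abstract

/-! ### Convergence of the inexact method of multipliers -/

/-- A nonnegative sequence that increases by summable amounts only converges. -/
lemma exists_tendsto_of_le_add_summable {d ε : ℕ → ℝ} (hd : ∀ j, 0 ≤ d j) (hε : ∀ j, 0 ≤ ε j)
    (hs : Summable ε) (h : ∀ j, d (j + 1) ≤ d j + ε j) : ∃ l, Tendsto d atTop (𝓝 l) := by
  have hanti : Antitone fun j => d j - ∑ i ∈ Finset.range j, ε i := by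
    refine antitone_nat_of_succ_le fun j => ?_
    rw [Finset.sum_range_succ]
    linarith [h j]
  have hbdd : BddBelow (range fun j => d j - ∑ i ∈ Finset.range j, ε i) := by
    refine ⟨-∑' i, ε i, ?_⟩
    rintro _ ⟨j, rfl⟩
    have := hs.sum_le_tsum (Finset.range j) fun i _ => hε i
    show -∑' i, ε i ≤ d j - ∑ i ∈ Finset.range j, ε i
    linarith [hd j]
  refine ⟨_, ((tendsto_atTop_ciInf hanti hbdd).add hs.hasSum.tendsto_sum_nat).congr fun j => ?_⟩
  ring

section Convergence

variable {X Y : Type*} [NormedAddCommGroup X] [InnerProductSpace ℝ X]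
  [NormedAddCommGroup Y] [InnerProductSpace ℝ Y] {g : X × Y → ℝ} {κ : ℝ} {c : X}

/-- The criterion on the augmented Lagrangian bounds the error in the residual, hence the error in
the updated multiplier. -/
lemma norm_residual_sub_le (hg : ConvexOn ℝ univ g) (hκ : 0 < κ) {r e : ℝ} (hr : 0 < r)
    (he : 0 ≤ e) {α : Y} {v w : X × Y}
    (hw : ∀ y, pertAugLag g κ c r w α ≤ pertAugLag g κ c r y α)
    (hv : pertAugLag g κ c r v α ≤ pertAugLag g κ c r w α + e ^ 2 / (2 * r)) :
    r * ‖v.2 - w.2‖ ≤ e := by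
  have h := pertAugLag_growth hg hw v
  have h1 : r / 2 * ‖v.2 - w.2‖ ^ 2 ≤ e ^ 2 / (2 * r) := by
    have : 0 ≤ κ * ‖v.1 - w.1‖ ^ 2 := by positivity
    linarith
  rw [le_div_iff₀ (by positivity)] at h1
  refine abs_le_of_sq_le_sq' ?_ he |>.2
  linarith

/-- The criterion on the augmented Lagrangian bounds the error in `x`. -/
lemma norm_sub_sq_le (hg : ConvexOn ℝ univ g) {r e : ℝ} (hr : 0 < r) {α : Y}
    {v w : X × Y} (hw : ∀ y, pertAugLag g κ c r w α ≤ pertAugLag g κ c r y α)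
    (hv : pertAugLag g κ c r v α ≤ pertAugLag g κ c r w α + e ^ 2 / (2 * r)) :
    κ * ‖v.1 - w.1‖ ^ 2 ≤ e ^ 2 / (2 * r) := by
  have h := pertAugLag_growth hg hw v
  have : 0 ≤ r / 2 * ‖v.2 - w.2‖ ^ 2 := by positivity
  linarith

lemma tendsto_of_tendsto_norm_sub_sq {E : Type*} [NormedAddCommGroup E] {a : ℕ → E}
    {b : E} {k : ℝ} (hk : 0 < k) {δ : ℕ → ℝ} (hδ : Tendsto δ atTop (𝓝 0))
    (h : ∀ j, k * ‖a j - b‖ ^ 2 ≤ δ j) : Tendsto a atTop (𝓝 b) := by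
  rw [tendsto_iff_norm_sub_tendsto_zero]
  have h1 : Tendsto (fun j => ‖a j - b‖ ^ 2) atTop (𝓝 0) := by
    refine squeeze_zero (fun j => by positivity) (g := fun j => δ j / k) (fun j => ?_) ?_
    · rw [le_div_iff₀ hk]
      linarith [h j]
    · simpa using hδ.div_const k
  have h2 := (Real.continuous_sqrt.tendsto 0).comp h1
  simpa [Function.comp_def, Real.sqrt_sq] using h2

/-- The distances of the multipliers to a dual solution converge, and the exact minimizers `w j` of
the augmented Lagrangians converge to the primal solution. -/
lemma IsKKTPair.tendsto_of_inexact_step (hg : ConvexOn ℝ univ g) (hκ : 0 < κ)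
    {ρ ε : ℕ → ℝ} {C : ℝ} (hC : 0 < C) (hρ : ∀ j, C ≤ ρ j) (hε : ∀ j, 0 ≤ ε j) (hs : Summable ε)
    {α : ℕ → Y} {w : ℕ → X × Y}
    (hw : ∀ j v, pertAugLag g κ c (ρ j) (w j) (α j) ≤ pertAugLag g κ c (ρ j) v (α j))
    (hα : ∀ j, ‖α (j + 1) - (α j - ρ j • (w j).2)‖ ≤ ε j)
    {x : X} {β : Y} (h : IsKKTPair g κ c x β) :
    (∃ l, Tendsto (fun j => ‖α j - β‖) atTop (𝓝 l)) ∧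
      Tendsto (fun j => ρ j • (w j).2) atTop (𝓝 0) ∧ Tendsto w atTop (𝓝 (x, 0)) := by
  have hρ0 : ∀ j, 0 < ρ j := fun j => hC.trans_le (hρ j)
  have hfejer := fun j => h.fejer hg (hρ0 j) (hw j)
  have hle1 : ∀ j, ‖α j - ρ j • (w j).2 - β‖ ≤ ‖α j - β‖ := by
    intro j
    refine (sq_le_sq₀ (norm_nonneg _) (norm_nonneg _)).1 ?_
    have h1 : 0 ≤ ‖ρ j • (w j).2‖ ^ 2 := by positivity
    have h2 : 0 ≤ 4 * κ * ρ j * ‖(w j).1 - x‖ ^ 2 := by have := hρ0 j; positivity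
    linarith [hfejer j]
  have hle2 : ∀ j, ‖α (j + 1) - β‖ ≤ ‖α j - ρ j • (w j).2 - β‖ + ε j := by
    intro j
    have e : α (j + 1) - β
        = (α j - ρ j • (w j).2 - β) + (α (j + 1) - (α j - ρ j • (w j).2)) := by abel
    rw [e]
    exact (norm_add_le _ _).trans (add_le_add_right (hα j) _)
  obtain ⟨l, hl⟩ := exists_tendsto_of_le_add_summable (d := fun j => ‖α j - β‖)
    (fun j => norm_nonneg _) hε hs fun j => (hle2 j).trans (by linarith [hle1 j])
  have hmid : Tendsto (fun j => ‖α j - ρ j • (w j).2 - β‖) atTop (𝓝 l) := by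
    have hlow : Tendsto (fun j => ‖α (j + 1) - β‖ - ε j) atTop (𝓝 l) := by
      simpa using ((tendsto_add_atTop_iff_nat 1).2 hl).sub hs.tendsto_atTop_zero
    exact tendsto_of_tendsto_of_tendsto_of_le_of_le hlow hl
      (fun j => sub_le_iff_le_add.2 (hle2 j)) hle1
  have hδ : Tendsto (fun j => ‖α j - β‖ ^ 2 - ‖α j - ρ j • (w j).2 - β‖ ^ 2) atTop (𝓝 0) := by
    simpa using (hl.pow 2).sub (hmid.pow 2)
  have hres : Tendsto (fun j => ρ j • (w j).2) atTop (𝓝 0) := by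
    refine tendsto_of_tendsto_norm_sub_sq one_pos hδ fun j => ?_
    have h2 : 0 ≤ 4 * κ * ρ j * ‖(w j).1 - x‖ ^ 2 := by have := hρ0 j; positivity
    rw [sub_zero]
    linarith [hfejer j]
  refine ⟨⟨l, hl⟩, hres, Tendsto.prodMk_nhds (x := x) (y := (0 : Y))
    (mx := fun j => (w j).1) (my := fun j => (w j).2) ?_ ?_⟩
  · refine tendsto_of_tendsto_norm_sub_sq (k := 4 * κ * C) (by positivity) hδ fun j => ?_
    have h1 : 0 ≤ ‖ρ j • (w j).2‖ ^ 2 := by positivity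
    have h2 : 4 * κ * C * ‖(w j).1 - x‖ ^ 2 ≤ 4 * κ * ρ j * ‖(w j).1 - x‖ ^ 2 := by
      gcongr
      exact hρ j
    linarith [hfejer j]
  · refine squeeze_zero_norm (fun j => ?_) (a := fun j => C⁻¹ * ‖ρ j • (w j).2‖) ?_
    · rw [norm_smul, Real.norm_eq_abs, abs_of_pos (hρ0 j), ← mul_assoc]
      refine le_mul_of_one_le_left (norm_nonneg _) ?_
      rw [inv_mul_eq_div, one_le_div hC]
      exact hρ j
    · simpa using hres.norm.const_mul C⁻¹

/-- Convergence of the inexact method of multipliers for the minimization of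
`g (x, y) + κ‖x - c‖²` subject to `y = 0`. -/
theorem exists_tendsto_isKKTPair [FiniteDimensional ℝ X] [FiniteDimensional ℝ Y]
    (hg : ConvexOn ℝ univ g) (hκ : 0 < κ)
    {ρ ε : ℕ → ℝ} {C : ℝ} (hC : 0 < C) (hρ : ∀ j, C ≤ ρ j) (hε : ∀ j, 0 ≤ ε j) (hs : Summable ε)
    {α : ℕ → Y} {v : ℕ → X × Y}
    (hv : ∀ j y, pertAugLag g κ c (ρ j) (v (j + 1)) (α j)
      ≤ pertAugLag g κ c (ρ j) y (α j) + ε j ^ 2 / (2 * ρ j))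
    (hα : ∀ j, α (j + 1) = α j - ρ j • (v (j + 1)).2) :
    ∃ x β, IsKKTPair g κ c x β ∧ Tendsto α atTop (𝓝 β) ∧ Tendsto v atTop (𝓝 (x, 0)) := by
  have hρ0 : ∀ j, 0 < ρ j := fun j => hC.trans_le (hρ j)
  choose w hw using fun j => exists_isMin_pertAugLag (c := c) hg hκ (hρ0 j) (α j)
  have hres : ∀ j, ρ j * ‖(v (j + 1)).2 - (w j).2‖ ≤ ε j := fun j =>
    norm_residual_sub_le hg hκ (hρ0 j) (hε j) (hw j) (hv j (w j))
  have hα' : ∀ j, ‖α (j + 1) - (α j - ρ j • (w j).2)‖ ≤ ε j := by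
    intro j
    have e : α (j + 1) - (α j - ρ j • (w j).2) = -(ρ j • ((v (j + 1)).2 - (w j).2)) := by
      rw [hα j, smul_sub]
      abel
    rw [e, norm_neg, norm_smul, Real.norm_eq_abs, abs_of_pos (hρ0 j)]
    exact hres j
  obtain ⟨x, β₀, h₀⟩ := exists_isKKTPair (c := c) hg hκ
  obtain ⟨⟨l, hl⟩, hstep, hwx⟩ := h₀.tendsto_of_inexact_step hg hκ hC hρ hε hs hw hα'
  have hε0 := hs.tendsto_atTop_zero
  have hdiff : Tendsto (fun j => v (j + 1) - w j) atTop (𝓝 0) := by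
    refine Tendsto.prodMk_nhds (x := (0 : X)) (y := (0 : Y))
      (mx := fun j => (v (j + 1)).1 - (w j).1) (my := fun j => (v (j + 1)).2 - (w j).2) ?_ ?_
    · refine tendsto_of_tendsto_norm_sub_sq hκ (δ := fun j => ε j ^ 2 / (2 * C)) ?_ fun j => ?_
      · simpa using (hε0.pow 2).div_const (2 * C)
      · rw [sub_zero]
        refine (norm_sub_sq_le hg (hρ0 j) (hw j) (hv j (w j))).trans ?_
        gcongr
        exact hρ j
    · refine squeeze_zero_norm (a := fun j => ε j / C) (fun j => ?_)
        (by simpa using hε0.div_const C)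
      rw [le_div_iff₀ hC, mul_comm]
      exact (mul_le_mul_of_nonneg_right (hρ j) (norm_nonneg _)).trans (hres j)
  have hvx : Tendsto v atTop (𝓝 (x, 0)) := by
    rw [← tendsto_add_atTop_iff_nat 1]
    simpa using hdiff.add hwx
  -- A cluster point `β` of the multipliers is again part of a Kuhn-Tucker pair.
  obtain ⟨D, hD⟩ := hl.bddAbove_range
  obtain ⟨β, -, φ, hφ, hβ⟩ := tendsto_subseq_of_bounded (x := α)
    (Metric.isBounded_closedBall (x := β₀) (r := D)) fun j => by
      rw [mem_closedBall_iff_norm]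
      exact hD ⟨j, rfl⟩
  have hβ' : Tendsto (fun k => α (φ k) - ρ (φ k) • (w (φ k)).2) atTop (𝓝 β) := by
    simpa using hβ.sub (hstep.comp hφ.tendsto_atTop)
  have hL := continuous_pertLag (κ := κ) (c := c) hg
  have hKKT : IsKKTPair g κ c x β := fun y =>
    le_of_tendsto_of_tendsto
      ((hL.tendsto ((x, 0), β)).comp ((hwx.comp hφ.tendsto_atTop).prodMk_nhds hβ'))
      (((hL.comp (Continuous.prodMk_right y)).tendsto β).comp hβ')
      (Eventually.of_forall fun k => (le_add_of_nonneg_right (by positivity)).trans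
        (pertLag_growth hg (hw (φ k)) y))
  -- The distance to `β` converges, and it tends to zero along a subsequence.
  obtain ⟨⟨l', hl'⟩, -, -⟩ := hKKT.tendsto_of_inexact_step hg hκ hC hρ hε hs hw hα'
  have hl0 : l' = 0 := tendsto_nhds_unique (hl'.comp hφ.tendsto_atTop)
    (tendsto_iff_norm_sub_tendsto_zero.1 hβ)
  exact ⟨x, β, hKKT, tendsto_iff_norm_sub_tendsto_zero.2 (hl0 ▸ hl'), hvx⟩

end Convergence

/-! ### The proximal point subproblem -/

/-- The infimum of a separable function, in the extended reals. All values are real, so no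
difference of infinities occurs. -/
lemma iInf_coe_sub_sub {ι κ μ : Type*} [Nonempty κ] {q : ι → ℝ} {a : κ → ℝ}
    {b : μ → ℝ} {r : ℝ} (hq : ∀ x, -r ≤ q x) {x₀ : ι} (hx₀ : q x₀ = -r) :
    (⨅ w : ι × κ × μ, ((q w.1 - a w.2.1 - b w.2.2 : ℝ) : EReal))
      = -((r : EReal) + (⨆ u, (a u : EReal)) + ⨆ z, (b z : EReal)) := by
  apply le_antisymm
  · rw [EReal.le_neg]
    set T : EReal := -⨅ w : ι × κ × μ, ((q w.1 - a w.2.1 - b w.2.2 : ℝ) : EReal) with hT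
    have hle : ∀ u z, ((r + a u + b z : ℝ) : EReal) ≤ T := by
      intro u z
      rw [hT, EReal.le_neg]
      refine (iInf_le _ (x₀, u, z)).trans (le_of_eq ?_)
      rw [hx₀, ← EReal.coe_neg]
      congr 1
      ring
    clear_value T
    rcases isEmpty_or_nonempty μ with hμ | ⟨⟨z₀⟩⟩
    · simp
    obtain ⟨u₀⟩ := ‹Nonempty κ›
    induction T using EReal.rec with
    | bot => exact absurd (hle u₀ z₀) (by simp [-EReal.coe_add])
    | top => exact le_top
    | coe m =>
      have hA : ∀ z, (⨆ u, (a u : EReal)) ≤ ((m - r - b z : ℝ) : EReal) := fun z =>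
        iSup_le fun u => by
          have := EReal.coe_le_coe_iff.1 (hle u z)
          exact EReal.coe_le_coe_iff.2 (by linarith)
      have hA₀ : (a u₀ : EReal) ≤ ⨆ u, (a u : EReal) := le_iSup (fun u => (a u : EReal)) u₀
      generalize (⨆ u, (a u : EReal)) = A at hA hA₀
      induction A using EReal.rec with
      | bot => exact absurd hA₀ (by simp)
      | top => exact absurd (hA z₀) (by simp [-EReal.coe_sub])
      | coe A =>
        have hB : (⨆ z, (b z : EReal)) ≤ ((m - r - A : ℝ) : EReal) := iSup_le fun z => by
          have := EReal.coe_le_coe_iff.1 (hA z)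
          exact EReal.coe_le_coe_iff.2 (by linarith)
        refine (add_le_add_right hB _).trans (le_of_eq ?_)
        rw [← EReal.coe_add, ← EReal.coe_add]
        congr 1
        ring
  · refine le_iInf fun w => ?_
    rw [EReal.neg_le]
    have h1 : -((q w.1 - a w.2.1 - b w.2.2 : ℝ) : EReal)
        ≤ ((r : EReal) + (a w.2.1 : EReal)) + (b w.2.2 : EReal) := by
      rw [← EReal.coe_neg, ← EReal.coe_add, ← EReal.coe_add]
      exact EReal.coe_le_coe_iff.2 (by linarith [hq w.1])
    exact h1.trans (add_le_add (add_le_add_right (le_iSup (fun u => (a u : EReal)) w.2.1) _)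
      (le_iSup (fun z => (b z : EReal)) w.2.2))

namespace PPASubproblem

variable {n p : ℕ} (P : PPASubproblem n p)

lemma inner_mulA (x : Vec p) (a : Vec n) : inner ℝ (P.mulA x) a = inner ℝ x (P.mulAT a) := by
  have h := Matrix.toEuclideanLin_conjTranspose_eq_adjoint P.A
  rw [Matrix.conjTranspose_eq_transpose_of_trivial] at h
  unfold mulA mulAT
  rw [h, LinearMap.adjoint_inner_right]

/-- The dual function of the split form is `-φ`. -/
lemma iInf_lagrangian (hsigma : 0 < P.sigma) (β : Vec n × Vec p) :
    (⨅ w : Vec p × Vec n × Vec p, ((P.lagrangian w β : ℝ) : EReal)) = -P.phi β := by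
  set s := P.mulAT β.1 - β.2 with hs
  set r := P.sigma / 2 * ‖s‖ ^ 2 - inner ℝ P.b β.1 + inner ℝ P.center s with hr
  -- completing the square in `x`
  set q : Vec p → ℝ := fun x => -r + 1 / (2 * P.sigma) * ‖x - P.center - P.sigma • s‖ ^ 2 with hq
  have hL : ∀ w : Vec p × Vec n × Vec p, P.lagrangian w β
      = q w.1 - (inner ℝ w.2.1 β.1 - P.h w.2.1) - (inner ℝ w.2.2 β.2 - P.f w.2.2) := by
    rintro ⟨x, u, z⟩
    simp only [lagrangian, q, r, f]
    rw [norm_sub_sq_real (x - P.center), inner_add_left, inner_sub_left, inner_mulA,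
      inner_sub_left z, inner_smul_right, inner_sub_left x P.center, norm_smul, mul_pow,
      Real.norm_eq_abs, sq_abs, hs, inner_sub_right x]
    field_simp
    ring
  simp_rw [hL]
  exact iInf_coe_sub_sub (r := r) (a := fun u => inner ℝ u β.1 - P.h u)
    (b := fun z => inner ℝ z β.2 - P.f z) (x₀ := P.center + P.sigma • s)
    (fun x => le_add_of_nonneg_right (by positivity)) (by simp [q])

/-- The nonsmooth part of the objective of the split form, as a function of `x` and of the residual
`y = (u - b + A x, z - x)`. -/
noncomputable def perturbation (v : Vec p × WithLp 2 (Vec n × Vec p)) : ℝ :=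
  P.h (v.2.fst + P.b - P.mulA v.1) + P.lam * l1norm (v.2.snd + v.1)

/-- The variables `(x, u, z)` of the split form, replaced by `x` and the residual. -/
noncomputable def toResidual (w : Vec p × Vec n × Vec p) : Vec p × WithLp 2 (Vec n × Vec p) :=
  (w.1, WithLp.toLp 2 (w.2.1 - P.b + P.mulA w.1, w.2.2 - w.1))

/-- The variables `(x, u, z)` of the split form recovered from `x` and the residual. -/
noncomputable def ofResidual (v : Vec p × WithLp 2 (Vec n × Vec p)) : Vec p × Vec n × Vec p :=
  (v.1, v.2.fst + P.b - P.mulA v.1, v.2.snd + v.1)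

lemma toResidual_ofResidual (v : Vec p × WithLp 2 (Vec n × Vec p)) :
    P.toResidual (P.ofResidual v) = v := by
  refine Prod.ext rfl ((WithLp.ofLp_injective 2) (Prod.ext ?_ ?_))
  · simp only [toResidual, ofResidual, WithLp.fst]
    abel
  · simp [toResidual, ofResidual]

lemma ofResidual_toResidual (w : Vec p × Vec n × Vec p) :
    P.ofResidual (P.toResidual w) = w := by
  refine Prod.ext rfl (Prod.ext ?_ ?_)
  · simp only [toResidual, ofResidual, WithLp.fst]
    abel
  · simp [toResidual, ofResidual]

lemma lagrangian_eq_pertLag (w : Vec p × Vec n × Vec p) (β : Vec n × Vec p) :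
    P.lagrangian w β = pertLag P.perturbation (1 / (2 * P.sigma)) P.center (P.toResidual w)
      (WithLp.toLp 2 β) := by
  have h : P.perturbation (P.toResidual w) = P.h w.2.1 + P.lam * l1norm w.2.2 := by
    have hu : w.2.1 - P.b + P.mulA w.1 + P.b - P.mulA w.1 = w.2.1 := by abel
    simp [perturbation, toResidual, hu]
  rw [pertLag, h, WithLp.prod_inner_apply]
  simp only [lagrangian, toResidual]
  ring

lemma augLagrangian_eq_pertAugLag (r : ℝ) (w : Vec p × Vec n × Vec p) (β : Vec n × Vec p) :
    P.augLagrangian r w β = pertAugLag P.perturbation (1 / (2 * P.sigma)) P.center r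
      (P.toResidual w) (WithLp.toLp 2 β) := by
  rw [pertAugLag, ← lagrangian_eq_pertLag, WithLp.prod_norm_sq_eq_of_L2]
  simp only [lagrangian, augLagrangian, toResidual, WithLp.fst, WithLp.snd]
  ring

lemma convexOn_l1norm {m : ℕ} : ConvexOn ℝ univ (l1norm : Vec m → ℝ) := by
  refine ⟨convex_univ, fun v _ w _ a b ha hb _ => ?_⟩
  simp only [l1norm, smul_eq_mul, Finset.mul_sum, ← Finset.sum_add_distrib]
  refine Finset.sum_le_sum fun i _ => ?_
  refine (abs_add_le _ _).trans (le_of_eq ?_)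
  simp [abs_mul, abs_of_nonneg ha, abs_of_nonneg hb]

lemma convexOn_perturbation (hconv : ConvexOn ℝ univ P.h) (hlam : 0 ≤ P.lam) :
    ConvexOn ℝ univ P.perturbation := by
  refine ⟨convex_univ, fun v _ w _ a b ha hb hab => ?_⟩
  have h1 : (a • v + b • w).2.fst + P.b - P.mulA (a • v + b • w).1
      = a • (v.2.fst + P.b - P.mulA v.1) + b • (w.2.fst + P.b - P.mulA w.1) := by
    have hb' : P.b = a • P.b + b • P.b := by rw [← add_smul, hab, one_smul]
    nth_rewrite 1 [hb']
    simp only [mulA, Prod.fst_add, Prod.snd_add, Prod.smul_fst, Prod.smul_snd, map_add, map_smul,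
      WithLp.add_fst, WithLp.smul_fst]
    module
  have h2 : (a • v + b • w).2.snd + (a • v + b • w).1
      = a • (v.2.snd + v.1) + b • (w.2.snd + w.1) := by
    simp only [Prod.fst_add, Prod.snd_add, Prod.smul_fst, Prod.smul_snd,
      WithLp.add_snd, WithLp.smul_snd]
    module
  have h3 := hconv.2 (mem_univ (v.2.fst + P.b - P.mulA v.1))
    (mem_univ (w.2.fst + P.b - P.mulA w.1)) ha hb hab
  have h4 := mul_le_mul_of_nonneg_left (convexOn_l1norm.2 (mem_univ (v.2.snd + v.1))
    (mem_univ (w.2.snd + w.1)) ha hb hab) hlam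
  unfold perturbation
  rw [h1, h2]
  simp only [smul_eq_mul] at h3 h4 ⊢
  linarith

lemma continuous_ofResidual : Continuous P.ofResidual := by
  have hA : Continuous P.mulA := (Matrix.toEuclideanLin P.A).continuous_of_finiteDimensional
  unfold ofResidual
  fun_prop

variable {P} in
/-- A minimizer of the Lagrangian among all points which is feasible provides a dual solution: weak
duality holds with equality. -/
lemma isDualSolution_of_forall_le (hsigma : 0 < P.sigma) {w : Vec p × Vec n × Vec p}
    (hw : w ∈ P.feasible) {β : Vec n × Vec p} (h : ∀ y, P.lagrangian w β ≤ P.lagrangian y β) :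
    P.IsDualSolution β := by
  have hval : -P.phi β = (P.lagrangian w β : EReal) := by
    rw [← P.iInf_lagrangian hsigma]
    exact le_antisymm (iInf_le _ w) (le_iInf fun y => EReal.coe_le_coe_iff.2 (h y))
  have hfeas : ∀ γ, P.lagrangian w γ = P.splitObjective w := by
    intro γ
    simp [lagrangian, splitObjective, hw.1, hw.2]
  refine ⟨?_, fun γ _ => ?_⟩
  · rw [lt_top_iff_ne_top]
    intro htop
    rw [htop] at hval
    simp at hval
  · show -P.phi γ ≤ -P.phi β
    rw [hval, ← P.iInf_lagrangian hsigma, hfeas β, ← hfeas γ]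
    exact iInf_le _ w

end PPASubproblem

end RankLasso

theorem mainTheorem3 {n p : ℕ} (P : RankLasso.PPASubproblem n p)
    (hconv : ConvexOn ℝ Set.univ P.h) (hlam : 0 < P.lam) (hsigma : 0 < P.sigma)
    (ρ ε : ℕ → ℝ) (hρ : ∃ c : ℝ, 0 < c ∧ ∀ j, c ≤ ρ j)
    (hε : ∀ j, 0 ≤ ε j) (hεsum : Summable ε)
    (x : ℕ → RankLasso.Vec p) (u : ℕ → RankLasso.Vec n) (z : ℕ → RankLasso.Vec p)
    (α : ℕ → RankLasso.Vec n × RankLasso.Vec p)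
    (hrun : P.IsALMRun ρ ε x u z α) :
    -- the dual problem is to maximize `-φ`
    (∀ β : RankLasso.Vec n × RankLasso.Vec p,
      (⨅ w : RankLasso.Vec p × RankLasso.Vec n × RankLasso.Vec p,
        ((P.lagrangian w β : ℝ) : EReal)) = -P.phi β) ∧
    -- the multipliers
    Bornology.IsBounded (Set.range α) ∧
    (∃ αstar : RankLasso.Vec n × RankLasso.Vec p,
      P.IsDualSolution αstar ∧ Filter.Tendsto α Filter.atTop (nhds αstar)) ∧
    -- the primal iterates
    Bornology.IsBounded (Set.range fun j => (x j, u j, z j)) ∧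
    (∃ (xstar : RankLasso.Vec p) (ustar : RankLasso.Vec n) (zstar : RankLasso.Vec p),
      P.IsSolution (xstar, ustar, zstar) ∧
      (∀ w, P.IsSolution w → w = (xstar, ustar, zstar)) ∧
      IsMinOn P.objective Set.univ xstar ∧
      (∀ y, IsMinOn P.objective Set.univ y → y = xstar) ∧
      Filter.Tendsto (fun j => (x j, u j, z j)) Filter.atTop
        (nhds (xstar, ustar, zstar))) := by
  open Set Filter Topology RankLasso RankLasso.PPASubproblem in
  obtain ⟨C, hC, hCρ⟩ := hρ
  have hg := P.convexOn_perturbation hconv hlam.le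
  have hκ : 0 < 1 / (2 * P.sigma) := by positivity
  obtain ⟨xs, β, hKKT, hα, hv⟩ := exists_tendsto_isKKTPair (c := P.center) hg hκ hC hCρ hε hεsum
    (α := fun j => WithLp.toLp 2 (α j)) (v := fun j => P.toResidual (x j, u j, z j))
    (fun j y => by
      -- the infimum in the stopping criterion is that of a function bounded below
      obtain ⟨w, hw⟩ := exists_isMin_pertAugLag (c := P.center) hg hκ (hC.trans_le (hCρ j))
        (WithLp.toLp 2 (α j))
      have hbdd : BddBelow (range fun w => P.augLagrangian (ρ j) w (α j)) := by
        refine ⟨pertAugLag P.perturbation (1 / (2 * P.sigma)) P.center (ρ j) w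
          (WithLp.toLp 2 (α j)), ?_⟩
        rintro _ ⟨y, rfl⟩
        exact (hw (P.toResidual y)).trans (P.augLagrangian_eq_pertAugLag _ _ _).ge
      have h1 := ciInf_le hbdd (P.ofResidual y)
      have h2 := hrun.criterion j
      rw [← P.toResidual_ofResidual y, ← augLagrangian_eq_pertAugLag,
        ← augLagrangian_eq_pertAugLag]
      linarith)
    (fun j => by
      show WithLp.toLp 2 (α (j + 1)) = _
      rw [hrun.multiplier_step j]
      rfl)
  have hαlim : Tendsto α atTop (𝓝 β.ofLp) :=
    ((WithLp.prod_continuous_ofLp 2 (Vec n) (Vec p)).tendsto β).comp hα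
  have hwlim : Tendsto (fun j => (x j, u j, z j)) atTop (𝓝 (P.ofResidual (xs, 0))) := by
    simpa [Function.comp_def, ofResidual_toResidual] using
      (P.continuous_ofResidual.tendsto (xs, 0)).comp hv
  -- the limit has residual zero, so it is feasible
  have hws : P.ofResidual (xs, 0) = (xs, P.b - P.mulA xs, xs) := by simp [ofResidual]
  rw [hws] at hwlim
  have hlag : ∀ y, P.lagrangian (xs, P.b - P.mulA xs, xs) β.ofLp ≤ P.lagrangian y β.ofLp := by
    intro y
    rw [← hws, lagrangian_eq_pertLag, lagrangian_eq_pertLag, toResidual_ofResidual]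
    exact hKKT _
  -- the restriction of the Lagrangian to the feasible set is the objective
  have hobj : ∀ y, pertLag P.perturbation (1 / (2 * P.sigma)) P.center (y, 0) β
      = P.objective y := by
    intro y
    simp [pertLag, perturbation, objective]
  have hgrowth : ∀ y, P.objective xs + 1 / (2 * P.sigma) * ‖y - xs‖ ^ 2 ≤ P.objective y := by
    intro y
    simpa only [hobj] using hKKT.growth hg (y, 0)
  have hmin : ∀ y, P.objective xs ≤ P.objective y := fun y =>
    (le_add_of_nonneg_right (by positivity)).trans (hgrowth y)
  have huniq : ∀ y, P.objective y ≤ P.objective xs → y = xs := by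
    intro y hy
    have h1 : 1 / (2 * P.sigma) * ‖y - xs‖ ^ 2 ≤ 0 := by linarith [hgrowth y]
    have h2 : ‖y - xs‖ ^ 2 ≤ 0 := nonpos_of_mul_nonpos_right h1 hκ
    exact sub_eq_zero.1 (norm_eq_zero.1 (pow_eq_zero_iff two_ne_zero |>.1
      (le_antisymm h2 (by positivity))))
  have hsplit : ∀ w ∈ P.feasible, P.splitObjective w = P.objective w.1 := by
    rintro ⟨x, u, z⟩ ⟨h1, h2⟩
    simp only at h1 h2
    simp [splitObjective, objective, h1, h2]
  have hfeas : (xs, P.b - P.mulA xs, xs) ∈ P.feasible := ⟨rfl, rfl⟩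
  refine ⟨P.iInf_lagrangian hsigma, Metric.isBounded_range_of_tendsto _ hαlim,
    ⟨β.ofLp, isDualSolution_of_forall_le hsigma hfeas hlag, hαlim⟩,
    Metric.isBounded_range_of_tendsto _ hwlim,
    xs, P.b - P.mulA xs, xs, ⟨hfeas, fun w hw => ?_⟩, fun w hw => ?_, fun y _ => hmin y,
    fun y hy => huniq y (hy (mem_univ xs)), hwlim⟩
  · show P.splitObjective _ ≤ P.splitObjective w
    rw [hsplit _ hfeas, hsplit _ hw]
    exact hmin w.1
  · have h1 : P.splitObjective w ≤ P.splitObjective _ := hw.2 hfeas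
    rw [hsplit _ hfeas, hsplit _ hw.1] at h1
    have h2 := huniq _ h1
    obtain ⟨y, v, t⟩ := w
    obtain ⟨⟨h3, h4⟩, -⟩ := hw
    simp only at h2 h3 h4
    rw [h3, h4, h2]
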